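/- \begin{theorem} Let $d\geq 1$ be an integer, let $R$ be a commutative artinian ring and let $\Lambda$ be an Artin $R$-algebra, that is, an $R$-algebra which is finitely generated as an $R$-module. Let $\operatorname{mod}\Lambda$ be the category of right $\Lambda$-modules of finite length. Let $\mathcal{M}$ be a $d$-cluster-tilting subcategory of $\operatorname{mod}\Lambda$, that is, a full subcategory closed under finite direct sums and direct summands which is functorially finite (every module $Y\in\operatorname{mod}\Lambda$ admits a morphism $X\to Y$ with $X\in\mathcal{M}$ through which every morphism $X'\to Y$ with $X'\in\mathcal{M}$ factors, and, dually, a morphism $Y\to X$ with $X\in\mathcal{M}$ through which every morphism $Y\to X'$ with $X'\in\mathcal{M}$ factors) and satisfies \begin{align*} \mathcal{M}&=\{X\in\operatorname{mod}\Lambda \mid \operatorname{Ext}^k_\Lambda(X,Z)=0\text{ for all } Z\in\mathcal{M} \text{ and all } 1\leq k\leq d-1\}\\ &=\{Y\in\operatorname{mod}\Lambda \mid \operatorname{Ext}^k_\Lambda(Z,Y)=0\text{ for all } Z\in\mathcal{M} \text{ and all } 1\leq k\leq d-1\}. \end{align*} Let $X,N\in\mathcal{M}$. Regard $\operatorname{Hom}_\Lambda(X,N)$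 as an $\operatorname{End}_\Lambda(X)$-module by precomposition. Then for each $\operatorname{End}_\Lambda(X)$-submodule $H\subseteq\operatorname{Hom}_\Lambda(X,N)$ there exist $M\in\mathcal{M}$ and a morphism $g\colon M\to N$ such that \begin{enumerate} \item $\operatorname{Im}\operatorname{Hom}_\Lambda(X,g)=H$, where $\operatorname{Hom}_\Lambda(X,g)\colon \operatorname{Hom}_\Lambda(X,M)\to\operatorname{Hom}_\Lambda(X,N)$ is composition with $g$; and \item $g$ is right $X$-determined in $\mathcal{M}$: every morphism $h\colon V\to N$ with $V\in\mathcal{M}$ and $\operatorname{Im}\operatorname{Hom}_\Lambda(X,h)\subseteq\operatorname{Im}\operatorname{Hom}_\Lambda(X,g)$ factors through $g$. \end{enumerate} \end{theorem} -/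

import Mathlib

open CategoryTheory

universe u w

section Subcategories

variable {A : Type u} [Ring A]

/-- The objects of `mod A`: the modules of finite length. Right `Λ`-modules are modules over
`A = Λᵐᵒᵖ`. -/
def finLengthModules (A : Type u) [Ring A] : ObjectProperty (ModuleCat.{u} A) :=
  fun X => IsFiniteLength A X

/-- A subcategory of `mod A` in the sense used throughout: a full subcategory (given by its class
of objects) that is closed under finite direct sums and direct summands. -/
structure IsAdditiveSubcategory (M : ObjectProperty (ModuleCat.{u} A)) : Prop where
  le_finLength : M ≤ finLengthModules A
  closedUnderFiniteSums : M.IsClosedUnderFiniteCoproducts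
  closedUnderSummands : M.IsStableUnderRetracts

/-- Every `Y` in `mod A` admits a right `M`-approximation `f : X ⟶ Y`. -/
def IsContravariantlyFinite (M : ObjectProperty (ModuleCat.{u} A)) : Prop :=
  ∀ Y : ModuleCat.{u} A, finLengthModules A Y →
    ∃ (X : ModuleCat.{u} A) (f : X ⟶ Y), M X ∧
      ∀ (X' : ModuleCat.{u} A) (f' : X' ⟶ Y), M X' → ∃ t : X' ⟶ X, t ≫ f = f'

/-- Every `Y` in `mod A` admits a left `M`-approximation `f : Y ⟶ X`. -/
def IsCovariantlyFinite (M : ObjectProperty (ModuleCat.{u} A)) : Prop :=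
  ∀ Y : ModuleCat.{u} A, finLengthModules A Y →
    ∃ (X : ModuleCat.{u} A) (f : Y ⟶ X), M X ∧
      ∀ (X' : ModuleCat.{u} A) (f' : Y ⟶ X'), M X' → ∃ t : X ⟶ X', f ≫ t = f'

/-- `M` is a `d`-cluster-tilting subcategory of `mod A`. -/
structure IsClusterTilting (d : ℕ) (M : ObjectProperty (ModuleCat.{u} A)) : Prop where
  isAdditiveSubcategory : IsAdditiveSubcategory M
  contravariantlyFinite : IsContravariantlyFinite M
  covariantlyFinite : IsCovariantlyFinite M
  /-- `M = {X ∈ mod A | Ext^k(X, M) = 0 for 1 ≤ k ≤ d - 1}` -/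
  mem_iff_ext_left : ∀ X : ModuleCat.{u} A, M X ↔
    (finLengthModules A X ∧ ∀ k : ℕ, 1 ≤ k → k < d →
      ∀ Z : ModuleCat.{u} A, M Z → Subsingleton (Abelian.Ext X Z k))
  /-- `M = {Y ∈ mod A | Ext^k(M, Y) = 0 for 1 ≤ k ≤ d - 1}` -/
  mem_iff_ext_right : ∀ Y : ModuleCat.{u} A, M Y ↔
    (finLengthModules A Y ∧ ∀ k : ℕ, 1 ≤ k → k < d →
      ∀ Z : ModuleCat.{u} A, M Z → Subsingleton (Abelian.Ext Z Y k))

/-- `Im Hom(X, g)` as an `End(X)`-submodule of `Hom(X, N)`. Mathlib's composition in `End X` is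
`e * e' = e' ≫ e`, and `Hom(X, N)` is a right `End X`-module by precomposition, that is, a
module over `(End X)ᵐᵒᵖ`. -/
noncomputable def homImage (X : ModuleCat.{u} A) {M N : ModuleCat.{u} A} (g : M ⟶ N) :
    Submodule (End X)ᵐᵒᵖ (X ⟶ N) :=
  LinearMap.range ((preadditiveCoyonedaObj X).map g).hom

theorem mem_homImage {X M N : ModuleCat.{u} A} (g : M ⟶ N) (f : X ⟶ N) :
    f ∈ homImage X g ↔ ∃ t : X ⟶ M, t ≫ g = f :=
  Iff.rfl

/-- The morphism `g : M ⟶ N` of the full subcategory `P` is right `X`-determined in `P`. -/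
def IsRightDetermined (P : ObjectProperty (ModuleCat.{u} A)) (X : ModuleCat.{u} A)
    {M N : ModuleCat.{u} A} (g : M ⟶ N) : Prop :=
  ∀ (V : ModuleCat.{u} A) (h : V ⟶ N), P V → homImage X h ≤ homImage X g →
    ∃ v : V ⟶ M, v ≫ g = h

end Subcategories

/-! It suffices to find `g : Y ⟶ N` of finite length such that any `h : V ⟶ N` factors through `g`
iff `t ≫ h ∈ H` for all `t : X ⟶ V` (`exists_finLength_rightDetermined`): composing `g` with a right
approximation of `Y` keeps this property for `V` in the subcategory.

To build `g`, present `X` by `n` generators and `m` relations `r`, so that `Hom(X, V)` is the kernel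
of the map `ρ : Vⁿ → Vᵐ` given by `r`. Then `H` is an `R`-submodule `S` of `Nⁿ`, and it is the
kernel of some `φ : Nⁿ → E` with `E` injective and finite over `R`. The condition on `h` says that
`φ ∘ hⁿ` vanishes on `ker ρ`, hence that it equals `χ ∘ ρ` for some `χ : Vᵐ → E`. By the adjunction
with coinduction, such a `χ` is an `A`-linear map from `V` to `m` copies of `Hom_R(A, E)`, and the
equation says that it lifts `h` to a pullback `Y`. -/

/-! ### Finite injective hulls over a commutative artinian ring -/

theorem exists_maximal_disjoint {α : Type*} [CompleteLattice α] [IsCompactlyGenerated α]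
    {P Q : α} (h : Disjoint P Q) :
    ∃ E, P ≤ E ∧ Disjoint E Q ∧ ∀ D, E ≤ D → Disjoint D Q → D ≤ E := by
  obtain ⟨E, hPE, hE⟩ := zorn_le_nonempty₀ {D : α | Disjoint D Q} (fun c hc hch y _ ↦
    ⟨sSup c, (hch.directedOn.disjoint_sSup_left).2 fun D hD ↦ hc hD, fun z ↦ le_sSup⟩) P h
  exact ⟨E, hPE, hE.1, fun D hED hD ↦ hE.2 hD hED⟩

theorem Module.Baer.of_retract {R : Type*} [Ring R] {M N : Type*} [AddCommGroup M]
    [AddCommGroup N] [Module R M] [Module R N] (hM : Module.Baer R M) (i : N →ₗ[R] M)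
    (p : M →ₗ[R] N) (hpi : ∀ x, p (i x) = x) : Module.Baer R N := by
  intro I g
  obtain ⟨g', hg'⟩ := hM I (i ∘ₗ g)
  exact ⟨p ∘ₗ g', fun x hx ↦ by simp [hg' x hx, hpi]⟩

/-- A submodule of an injective module has an injective essential extension inside it. -/
theorem Module.Baer.exists_essential_extension {R : Type*} [Ring R] {I : Type*} [AddCommGroup I]
    [Module R I] (hI : Module.Baer R I) (Q : Submodule R I) :
    ∃ E : Submodule R I, Q ≤ E ∧ Module.Baer R E ∧
      ∀ D : Submodule R I, D ≤ E → Disjoint D Q → D = ⊥ := by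
  -- `C` is a complement of `Q`, and `E ≥ Q` is a complement of `C`. An endomorphism `e` of `I` that
  -- fixes `E` and kills `C` turns out to be a retraction onto `E`.
  obtain ⟨C, -, hCQ, hCmax⟩ := exists_maximal_disjoint (disjoint_bot_left (a := Q))
  obtain ⟨E, hQE, hEC, hEmax⟩ := exists_maximal_disjoint hCQ.symm
  let i : E →ₗ[R] I ⧸ C := C.mkQ ∘ₗ E.subtype
  have hi : Function.Injective i := by
    rw [← LinearMap.ker_eq_bot, LinearMap.ker_eq_bot']
    intro x hx
    have hxC : (x : I) ∈ C := by simpa [i] using hx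
    exact Subtype.ext (Submodule.disjoint_def.1 hEC _ x.2 hxC)
  obtain ⟨f, hf⟩ := Module.Baer.extension_property hI i hi E.subtype
  let e : I →ₗ[R] I := f ∘ₗ C.mkQ
  have heE : ∀ x ∈ E, e x = x := fun x hx ↦
    LinearMap.congr_fun hf ⟨x, hx⟩
  have heC : C ≤ LinearMap.ker e := fun x hx ↦ by
    have : C.mkQ x = 0 := by simpa using hx
    simp [e, this]
  have hker : LinearMap.ker e ≤ C := by
    refine hCmax _ heC ?_
    rw [Submodule.disjoint_def]
    intro x hx hxQ
    rw [← heE x (hQE hxQ)]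
    exact hx
  have hrange : LinearMap.range e ≤ E := by
    refine hEmax _ (fun x hx ↦ ⟨x, heE x hx⟩) ?_
    rw [Submodule.disjoint_def]
    rintro _ ⟨y, rfl⟩ hy
    have hD : (Submodule.comap e C) ≤ C := by
      refine hCmax _ (fun z hz ↦ ?_) ?_
      · have : e z = 0 := heC hz
        simp [this]
      · rw [Submodule.disjoint_def]
        intro z hz hzQ
        have : e z = z := heE z (hQE hzQ)
        rw [Submodule.mem_comap, this] at hz
        exact Submodule.disjoint_def.1 hCQ z hz hzQ
    exact heC (hD hy)
  refine ⟨E, hQE, ?_, fun D hDE hDQ ↦ ?_⟩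
  · exact hI.of_retract E.subtype (e.codRestrict E fun x ↦ hrange ⟨x, rfl⟩)
      fun x ↦ Subtype.ext (heE x x.2)
  · have hD : C ⊔ D ≤ C := by
      refine hCmax _ le_sup_left ?_
      rw [Submodule.disjoint_def]
      intro x hx hxQ
      obtain ⟨c, hc, y, hy, rfl⟩ := Submodule.mem_sup.1 hx
      have hcE : c ∈ E := by
        have := E.sub_mem (hQE hxQ) (hDE hy)
        simpa using this
      have : c = 0 := Submodule.disjoint_def.1 hEC c hcE hc
      subst this
      rw [zero_add] at hxQ ⊢
      exact Submodule.disjoint_def.1 hDQ y hy hxQ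
    exact le_bot_iff.1 (fun x hx ↦ Submodule.disjoint_def.1 hEC x (hDE hx)
      (hD (Submodule.mem_sup_right hx)))

/-- Multiplication by finitely many generators of `J` maps the `J ^ (k + 1)`-torsion to a finite
power of the `J ^ k`-torsion, and its kernel is the `J`-torsion. -/
theorem Submodule.isNoetherian_torsionBySet_pow {R : Type*} [CommRing R] [IsNoetherianRing R]
    {M : Type*} [AddCommGroup M] [Module R M] (J : Ideal R)
    (h : IsNoetherian R (torsionBySet R M (J : Set R))) (k : ℕ) :
    IsNoetherian R (torsionBySet R M ((J ^ k : Ideal R) : Set R)) := by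
  induction k with
  | zero =>
    have : torsionBySet R M ((J ^ 0 : Ideal R) : Set R) = ⊥ := by
      rw [eq_bot_iff]
      intro x hx
      rw [mem_torsionBySet_iff] at hx
      simpa using hx ⟨1, by simp⟩
    rw [this]
    infer_instance
  | succ k ih =>
    obtain ⟨s, hs⟩ := (isNoetherianRing_iff_ideal_fg R).1 inferInstance J
    let T := torsionBySet R M ((J ^ (k + 1) : Ideal R) : Set R)
    let f : T →ₗ[R] (s → torsionBySet R M ((J ^ k : Ideal R) : Set R)) :=
      LinearMap.pi fun g ↦ LinearMap.codRestrict _ (LinearMap.lsmul R M (g : R) ∘ₗ T.subtype) (by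
        rintro ⟨x, hx⟩
        rw [mem_torsionBySet_iff] at hx ⊢
        rintro ⟨a, ha⟩
        have hg : (g : R) ∈ J := hs ▸ Ideal.subset_span g.2
        simpa [mul_smul] using hx ⟨a * g, by rw [pow_succ]; exact Ideal.mul_mem_mul ha hg⟩)
    have hker : ∀ x : LinearMap.ker f, ((x : T) : M) ∈ torsionBySet R M (J : Set R) := by
      rintro ⟨⟨x, hxT⟩, hx⟩
      have hle : J ≤ LinearMap.ker (LinearMap.toSpanSingleton R M x) := by
        rw [← hs, Ideal.span_le]
        intro g hg
        have := congrArg Subtype.val (congrFun (LinearMap.mem_ker.1 hx) ⟨g, hg⟩)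
        simpa [f] using this
      rw [mem_torsionBySet_iff]
      rintro ⟨a, ha⟩
      simpa using hle ha
    have hN : IsNoetherian R (LinearMap.ker f) :=
      isNoetherian_of_injective
        (LinearMap.codRestrict _ (T.subtype ∘ₗ (LinearMap.ker f).subtype) hker)
        (fun x y hxy ↦ by
          have := congrArg Subtype.val hxy
          exact Subtype.ext (Subtype.ext this))
    exact isNoetherian_of_range_eq_ker (LinearMap.ker f).subtype f (by simp)

/-- A finitely generated module over a commutative artinian ring embeds into a finitely generated
injective module. -/
theorem exists_finite_baer_embedding {R : Type u} [CommRing R] [IsArtinianRing R] (Q : Type u)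
    [AddCommGroup Q] [Module R Q] [Module.Finite R Q] :
    ∃ (E : Type u) (_ : AddCommGroup E) (_ : Module R E) (i : Q →ₗ[R] E),
      Module.Baer R E ∧ Module.Finite R E ∧ Function.Injective i := by
  let I := Injective.under (ModuleCat.of R Q)
  let ι : ModuleCat.of R Q ⟶ I := Injective.ι _
  have : Injective (ModuleCat.of R I) := inferInstanceAs (Injective (Injective.under _))
  have hI : Module.Baer R I :=
    Module.Baer.of_injective (Module.injective_module_of_injective_object R I)
  have hinj : Function.Injective ι.hom := (ModuleCat.mono_iff_injective ι).1 inferInstance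
  obtain ⟨E, hQE, hE, hess⟩ := hI.exists_essential_extension (LinearMap.range ι.hom)
  refine ⟨E, inferInstance, inferInstance,
    ι.hom.codRestrict E fun x ↦ hQE ⟨x, rfl⟩, hE, ?_, fun x y hxy ↦
      hinj (congrArg Subtype.val hxy)⟩
  -- The `J`-torsion `S` is semisimple, so essentiality forces it into the image of `Q`: a
  -- complement of the intersection would miss `Q`. Thus `S` is noetherian, and so is `E` because
  -- `J` is nilpotent.
  let J := Ring.jacobson R
  let S := Submodule.torsionBySet R E (J : Set R)
  have hS : IsSemisimpleModule R S :=
    ((Submodule.torsionBySet_isTorsionBySet (R := R) (M := E) (J : Set R)).isSemisimpleModule_iff).1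
      inferInstance
  have hSQ : S.map E.subtype ≤ LinearMap.range ι.hom := by
    obtain ⟨D, hD⟩ := exists_isCompl
      ((LinearMap.range ι.hom).comap (E.subtype ∘ₗ S.subtype))
    have hD0 : D.map (E.subtype ∘ₗ S.subtype) = ⊥ := by
      refine hess _ ?_ ?_
      · rintro _ ⟨x, -, rfl⟩
        exact (x : E).2
      · rw [Submodule.disjoint_def]
        rintro _ ⟨x, hx, rfl⟩ hxQ
        rw [Submodule.disjoint_def.1 hD.disjoint x hxQ hx, map_zero]
    have hD1 : D = ⊥ := Submodule.map_injective_of_injective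
      (E.subtype_injective.comp S.subtype_injective : Function.Injective (E.subtype ∘ₗ S.subtype))
      (hD0.trans (Submodule.map_bot _).symm)
    rw [hD1] at hD
    have htop := eq_top_of_isCompl_bot hD
    rintro _ ⟨x, hx, rfl⟩
    have : (⟨x, hx⟩ : S) ∈ (LinearMap.range ι.hom).comap (E.subtype ∘ₗ S.subtype) :=
      htop ▸ Submodule.mem_top
    exact this
  have hSN : IsNoetherian R S := by
    have : IsNoetherian R (LinearMap.range ι.hom) := inferInstance
    exact isNoetherian_of_injective
      (LinearMap.codRestrict (LinearMap.range ι.hom) (E.subtype ∘ₗ S.subtype)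
        fun x ↦ hSQ ⟨x, x.2, rfl⟩)
      (fun x y hxy ↦ by
        have := congrArg Subtype.val hxy
        exact Subtype.ext (Subtype.ext this))
  obtain ⟨k, hk⟩ := IsSemiprimaryRing.isNilpotent (R := R)
  have := Submodule.isNoetherian_torsionBySet_pow (M := E) J hSN k
  have htop : Submodule.torsionBySet R E ((J ^ k : Ideal R) : Set R) = ⊤ := by
    rw [eq_top_iff]
    intro x _
    rw [Submodule.mem_torsionBySet_iff]
    rintro ⟨a, ha⟩
    have ha0 : a ∈ (0 : Ideal R) := hk ▸ ha
    have : a = 0 := by simpa using ha0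
    simp [this]
  rw [htop] at this
  have := isNoetherian_of_linearEquiv (Submodule.topEquiv (R := R) (M := E))
  infer_instance

/-! ### Coinduced modules and the pullback -/

/-- The `A`-module coinduced from an `R`-module `E`: the `R`-linear maps `A → E`, on which `A`
acts by right multiplication on the argument. -/
def Coinduced (R A E : Type*) [CommRing R] [Ring A] [Algebra R A] [AddCommGroup E] [Module R E] :=
  A →ₗ[R] E

namespace Coinduced

variable {R A E : Type*} [CommRing R] [Ring A] [Algebra R A] [AddCommGroup E] [Module R E]

instance : AddCommGroup (Coinduced R A E) := inferInstanceAs (AddCommGroup (A →ₗ[R] E))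

instance : Module R (Coinduced R A E) := inferInstanceAs (Module R (A →ₗ[R] E))

instance : FunLike (Coinduced R A E) A E := inferInstanceAs (FunLike (A →ₗ[R] E) A E)

instance : LinearMapClass (Coinduced R A E) R A E :=
  inferInstanceAs (LinearMapClass (A →ₗ[R] E) R A E)

@[ext]
theorem ext {f g : Coinduced R A E} (h : ∀ a, f a = g a) : f = g := DFunLike.ext _ _ h

@[simp]
theorem add_apply (f g : Coinduced R A E) (a : A) : (f + g) a = f a + g a := rfl

@[simp]
theorem zero_apply (a : A) : (0 : Coinduced R A E) a = 0 := rfl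

@[simp]
theorem sum_apply {ι : Type*} (s : Finset ι) (f : ι → Coinduced R A E) (a : A) :
    (∑ i ∈ s, f i) a = ∑ i ∈ s, f i a :=
  LinearMap.sum_apply s f a

@[simp]
theorem smul_apply (r : R) (f : Coinduced R A E) (a : A) : (r • f) a = r • f a := rfl

instance : SMul A (Coinduced R A E) where
  smul b f := LinearMap.comp (R₁ := R) (f : A →ₗ[R] E) (LinearMap.mulRight R b)

@[simp]
theorem ring_smul_apply (b : A) (f : Coinduced R A E) (a : A) : (b • f) a = f (a * b) := rfl

instance : Module A (Coinduced R A E) where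
  one_smul f := by ext; simp
  mul_smul a b f := by ext; simp [mul_assoc]
  smul_zero a := by ext; simp
  smul_add a f g := by ext; simp
  add_smul a b f := by ext; simp [mul_add]
  zero_smul f := by ext; simp

instance : IsScalarTower R A (Coinduced R A E) where
  smul_assoc r a f := by ext; simp

instance [IsNoetherianRing R] [Module.Finite R A] [Module.Finite R E] :
    Module.Finite R (Coinduced R A E) :=
  inferInstanceAs (Module.Finite R (A →ₗ[R] E))

/-- The `A`-linear map to the coinduced module that corresponds to an `R`-linear map. -/
def lift {V : Type*} [AddCommGroup V] [Module R V] [Module A V] [IsScalarTower R A V]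
    (f : V →ₗ[R] E) : V →ₗ[A] Coinduced R A E where
  toFun v := f ∘ₗ (LinearMap.toSpanSingleton A V v).restrictScalars R
  map_add' v w := by
    apply Coinduced.ext
    intro a
    change f (a • (v + w)) = f (a • v) + f (a • w)
    rw [smul_add, map_add]
  map_smul' b v := by
    apply Coinduced.ext
    intro a
    change f (a • b • v) = f ((a * b) • v)
    rw [mul_smul]

@[simp]
theorem lift_apply {V : Type*} [AddCommGroup V] [Module R V] [Module A V] [IsScalarTower R A V]
    (f : V →ₗ[R] E) (v : V) (a : A) : lift f v a = f (a • v) := rfl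

end Coinduced

/-- A map to an injective module that vanishes on the kernel of `f` factors through `f`. -/
theorem Module.Baer.exists_comp_eq_of_ker_le {R : Type*} [Ring R] {E M N : Type*}
    [AddCommGroup E] [AddCommGroup M] [AddCommGroup N] [Module R E] [Module R M] [Module R N]
    (hE : Module.Baer R E) (f : M →ₗ[R] N) (g : M →ₗ[R] E)
    (h : LinearMap.ker f ≤ LinearMap.ker g) : ∃ k : N →ₗ[R] E, k ∘ₗ f = g := by
  obtain ⟨k, hk⟩ := Module.Baer.extension_property hE ((LinearMap.ker f).liftQ f le_rfl)
    (LinearMap.ker_eq_bot.1 (Submodule.ker_liftQ_eq_bot _ _ _ le_rfl))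
    ((LinearMap.ker f).liftQ g h)
  refine ⟨k, LinearMap.ext fun x ↦ ?_⟩
  simpa using LinearMap.congr_fun hk ((LinearMap.ker f).mkQ x)

/-- The pullback of `N → (Coinduced R A E)ⁿ` and `(Coinduced R A E)ᵐ → (Coinduced R A E)ⁿ`, where
the first map has components `φ i` and the second one is given by the matrix `r`. -/
def coinducedPullback {R A E N : Type*} [CommRing R] [Ring A] [Algebra R A] [AddCommGroup E]
    [Module R E] [AddCommGroup N] [Module R N] [Module A N] {n m : ℕ}
    (φ : Fin n → N →ₗ[R] E) (r : Fin m → Fin n → A) :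
    Submodule A (N × (Fin m → Coinduced R A E)) where
  -- Each side is a function of `a`, an element of the coinduced module. The matrix acts by left
  -- multiplication on the argument, which commutes with the action of `A`.
  carrier := {y | ∀ i a, φ i (a • y.1) = ∑ j, y.2 j (r j i * a)}
  add_mem' {y z} hy hz i a := by
    simp [smul_add, hy i a, hz i a, Finset.sum_add_distrib]
  zero_mem' i a := by simp
  smul_mem' b y hy i a := by
    have := hy i (a * b)
    simpa [mul_smul, mul_assoc] using this

/-! ### Right determined morphisms over an Artin algebra -/

/-- **Auslander's theorem** on the existence of right determined morphisms, for modules over an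
Artin algebra. -/
theorem exists_finLength_rightDetermined {R : Type u} [CommRing R] [IsArtinianRing R]
    {A : Type u} [Ring A] [Algebra R A] [Module.Finite R A]
    (X N : ModuleCat.{u} A) (hX : finLengthModules A X) (hN : finLengthModules A N)
    (H : Submodule (End X)ᵐᵒᵖ (X ⟶ N)) :
    ∃ (Y : ModuleCat.{u} A) (g : Y ⟶ N), finLengthModules A Y ∧
      ∀ (V : ModuleCat.{u} A) (h : V ⟶ N),
        (∃ v : V ⟶ Y, v ≫ g = h) ↔ ∀ t : X ⟶ V, t ≫ h ∈ H := by
  let mR (V : ModuleCat.{u} A) : Module R V := Module.restrictScalars R A V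
  have tR (V : ModuleCat.{u} A) : IsScalarTower R A V := IsScalarTower.restrictScalars R A V
  obtain ⟨_, _⟩ := isFiniteLength_iff_isNoetherian_isArtinian.1 hX
  obtain ⟨_, _⟩ := isFiniteLength_iff_isNoetherian_isArtinian.1 hN
  have : IsNoetherianRing A := isNoetherian_of_tower R inferInstance
  have : Module.Finite R N := Module.Finite.trans A N
  obtain ⟨n, p, hp⟩ := Module.Finite.exists_fin' A X
  obtain ⟨m, r, hr⟩ := Submodule.fg_iff_exists_fin_generating_family.1
    (IsNoetherian.noetherian (LinearMap.ker p))
  let x : Fin n → X := fun i ↦ p (Pi.single i 1)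
  have hpx : ∀ c, p c = ∑ i, c i • x i := fun c ↦ by
    conv_lhs => rw [LinearMap.pi_apply_eq_sum_univ p c]
    refine Finset.sum_congr rfl fun i _ ↦ ?_
    congr 2
    ext j
    simp [Pi.single_apply, eq_comm]
  have hxspan : ∀ {V : ModuleCat.{u} A} (s t : X ⟶ V), (∀ i, s (x i) = t (x i)) → s = t := by
    intro V s t hst
    ext y
    obtain ⟨c, rfl⟩ := hp y
    simp [hpx, hst]
  have hrel : ∀ j, ∑ i, r j i • x i = 0 := fun j ↦ by
    rw [← hpx]
    exact LinearMap.mem_ker.1 (hr ▸ Submodule.subset_span ⟨j, rfl⟩)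
  -- maps out of `X` are the solutions of the relations `r`
  have hdesc : ∀ (V : ModuleCat.{u} A) (v : Fin n → V), (∀ j, ∑ i, r j i • v i = 0) →
      ∃ t : X ⟶ V, ∀ i, t (x i) = v i := by
    intro V v hv
    let q : (Fin n → A) →ₗ[A] V := Fintype.linearCombination A v
    have hq : LinearMap.ker p ≤ LinearMap.ker q := by
      rw [← hr, Submodule.span_le]
      rintro _ ⟨j, rfl⟩
      simpa [q, Fintype.linearCombination_apply] using hv j
    refine ⟨ModuleCat.ofHom ((LinearMap.ker p).liftQ q hq ∘ₗ
      (p.quotKerEquivOfSurjective hp).symm.toLinearMap), fun i ↦ ?_⟩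
    have : (p.quotKerEquivOfSurjective hp).symm (x i) =
        (LinearMap.ker p).mkQ (Pi.single i 1) := by
      rw [LinearEquiv.symm_apply_eq]
      rfl
    simp [this, q, Fintype.linearCombination_apply]
  let S : Submodule R (Fin n → N) :=
    { carrier := {y | ∃ t ∈ H, ∀ i, t (x i) = y i}
      add_mem' := by
        rintro _ _ ⟨s, hs, hsy⟩ ⟨t, ht, hty⟩
        exact ⟨s + t, H.add_mem hs ht, fun i ↦ by simp [← hsy, ← hty]⟩
      zero_mem' := ⟨0, H.zero_mem, fun i ↦ by simp⟩
      smul_mem' := by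
        rintro a y ⟨t, ht, hty⟩
        -- Scalars from `R` are central in `A`, hence act on `X` by endomorphisms, and `H` is stable
        -- under these.
        let e : End X := ModuleCat.ofHom (DistribSMul.toLinearMap A X a)
        refine ⟨e ≫ t, H.smul_mem (MulOpposite.op e) ht, fun i ↦ ?_⟩
        rw [Pi.smul_apply, ← hty]
        exact (t.hom.restrictScalars R).map_smul a (x i) }
  have hS : ∀ t : X ⟶ N, (fun i ↦ t (x i)) ∈ S ↔ t ∈ H := fun t ↦
    ⟨fun ⟨s, hs, hst⟩ ↦ hxspan s t hst ▸ hs, fun ht ↦ ⟨t, ht, fun _ ↦ rfl⟩⟩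
  obtain ⟨E, _, _, i, hE, _, hi⟩ := exists_finite_baer_embedding (R := R) ((Fin n → N) ⧸ S)
  let φ : (Fin n → N) →ₗ[R] E := i ∘ₗ S.mkQ
  have hφ : ∀ y, φ y = 0 ↔ y ∈ S := fun y ↦ by
    simp [φ, map_eq_zero_iff i hi]
  let φ' : Fin n → N →ₗ[R] E := fun i ↦ φ ∘ₗ LinearMap.single R (fun _ ↦ N) i
  have hφ' : ∀ y, φ y = ∑ i, φ' i (y i) := fun y ↦ by
    simp only [φ', LinearMap.comp_apply, ← map_sum]
    congr 1
    exact (Finset.univ_sum_single y).symm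
  let Y := coinducedPullback φ' r
  refine ⟨ModuleCat.of A Y, ModuleCat.ofHom (LinearMap.fst A _ _ ∘ₗ Y.subtype), ?_, fun V h ↦
    ⟨?_, fun hH ↦ ?_⟩⟩
  · have : Module.Finite R (N × (Fin m → Coinduced R A E)) := inferInstance
    have : IsNoetherian A (N × (Fin m → Coinduced R A E)) := isNoetherian_of_tower R inferInstance
    have : IsArtinian A (N × (Fin m → Coinduced R A E)) := isArtinian_of_tower R inferInstance
    exact isFiniteLength_iff_isNoetherian_isArtinian.2
      ⟨inferInstanceAs (IsNoetherian A Y), inferInstanceAs (IsArtinian A Y)⟩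
  · rintro ⟨v, rfl⟩ t
    rw [← hS, ← hφ, hφ']
    let y : Fin n → Y := fun i ↦ v (t (x i))
    have hy : ∀ j, ∑ i, r j i • y i = 0 := fun j ↦ by
      have := congrArg (fun z ↦ v (t z)) (hrel j)
      simpa [y] using this
    -- Evaluation at `1` turns `r • f` into `f r`.
    have hy2 : ∀ j, ∑ i, (y i).1.2 j (r j i) = 0 := fun j ↦ by
      have := congrArg (fun z : Y ↦ z.1.2 j 1) (hy j)
      simpa [Prod.snd_sum] using this
    have : ∀ i, φ' i (y i).1.1 = ∑ j, (y i).1.2 j (r j i) := fun i ↦ by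
      simpa using (y i).2 i 1
    change ∑ i, φ' i (y i).1.1 = 0
    simp_rw [this]
    rw [Finset.sum_comm]
    exact Finset.sum_eq_zero fun j _ ↦ hy2 j
  · let hR : V →ₗ[R] N := h.hom.restrictScalars R
    let ρ : (Fin n → V) →ₗ[R] (Fin m → V) := LinearMap.pi fun j ↦ ∑ i,
      (Algebra.lsmul R R V (r j i)) ∘ₗ LinearMap.proj i
    let ψ : (Fin n → V) →ₗ[R] E := ∑ i, φ' i ∘ₗ hR ∘ₗ LinearMap.proj i
    -- A vector in `ker ρ` is a map `t : X ⟶ V`, on which `ψ` is `φ` of `t ≫ h ∈ H`, that is, zero.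
    obtain ⟨χ, hχ⟩ := hE.exists_comp_eq_of_ker_le ρ ψ (by
      intro v hv
      obtain ⟨t, ht⟩ := hdesc V v fun j ↦ by
        simpa [ρ] using congrFun (LinearMap.mem_ker.1 hv) j
      have := (hφ _).2 ((hS _).2 (hH t))
      rw [hφ'] at this
      simpa [ψ, hR, ht] using this)
    have hχ' : ∀ (i : Fin n) (v : V), φ' i (h v) = ∑ j, χ (Pi.single j (r j i • v)) := by
      intro i v
      have hρ : ρ (Pi.single i v) = fun j ↦ r j i • v := by
        ext j
        simp only [ρ, LinearMap.pi_apply, LinearMap.sum_apply, LinearMap.comp_apply,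
          LinearMap.proj_apply, Algebra.lsmul_coe]
        rw [Finset.sum_eq_single i (fun k _ hk ↦ by simp [hk]) (by simp), Pi.single_eq_same]
      have hψ : ψ (Pi.single i v) = φ' i (h v) := by
        simp only [ψ, LinearMap.sum_apply, LinearMap.comp_apply, LinearMap.proj_apply]
        rw [Finset.sum_eq_single i (fun k _ hk ↦ by simp [hk]) (by simp), Pi.single_eq_same]
        rfl
      rw [← map_sum, Finset.univ_sum_single, ← hρ, ← hψ, ← hχ, LinearMap.comp_apply]
    let c : V →ₗ[A] (Fin m → Coinduced R A E) :=
      LinearMap.pi fun j ↦ Coinduced.lift (χ ∘ₗ LinearMap.single R (fun _ ↦ V) j)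
    refine ⟨ModuleCat.ofHom ((h.hom.prod c).codRestrict Y fun v i a ↦ ?_), ?_⟩
    · simpa [c, mul_smul] using hχ' i (a • v)
    · ext v
      rfl

/-! ### Passage to the cluster-tilting subcategory -/

theorem mainTheorem4 {R : Type w} [CommRing R] [IsArtinianRing R]
    {Λ : Type u} [Ring Λ] [Algebra R Λ] [Module.Finite R Λ]
    (d : ℕ) (hd : 1 ≤ d)
    (ℳ : ObjectProperty (ModuleCat.{u} Λᵐᵒᵖ)) (hℳ : IsClusterTilting d ℳ)
    (X N : ModuleCat.{u} Λᵐᵒᵖ) (hX : ℳ X) (hN : ℳ N)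
    (H : Submodule (End X)ᵐᵒᵖ (X ⟶ N)) :
    ∃ (M : ModuleCat.{u} Λᵐᵒᵖ) (g : M ⟶ N),
      ℳ M ∧ IsRightDetermined ℳ X g ∧ homImage X g = H := by
  have hfin := hℳ.isAdditiveSubcategory.le_finLength
  -- The image of `R` in `Λᵐᵒᵖ` is a commutative artinian ring in the universe of `Λ`, where the
  -- injective modules must live.
  let R' := (⊥ : Subalgebra R Λᵐᵒᵖ)
  let _ : CommRing R' :=
    { (inferInstance : Ring R') with
      mul_comm := by
        rintro ⟨a, ha⟩ ⟨b, hb⟩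
        obtain ⟨r, rfl⟩ := Algebra.mem_bot.1 ha
        exact Subtype.ext (Algebra.commutes r b) }
  let _ : Algebra R' Λᵐᵒᵖ :=
    { algebraMap := R'.val.toRingHom
      commutes' := by
        rintro ⟨a, ha⟩ b
        obtain ⟨r, rfl⟩ := Algebra.mem_bot.1 ha
        exact Algebra.commutes r b
      smul_def' := fun _ _ ↦ rfl }
  have : IsArtinianRing R' := Function.Surjective.isArtinianRing
    (f := algebraMap R R') fun y ↦ by
      obtain ⟨r, hr⟩ := Algebra.mem_bot.1 y.2
      exact ⟨r, Subtype.ext hr⟩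
  have : Module.Finite R Λᵐᵒᵖ := Module.Finite.equiv (MulOpposite.opLinearEquiv R)
  have : Module.Finite R' Λᵐᵒᵖ := Module.Finite.of_restrictScalars_finite R R' Λᵐᵒᵖ
  obtain ⟨Y, g, hY, hg⟩ := exists_finLength_rightDetermined (R := R') X N (hfin X hX) (hfin N hN) H
  obtain ⟨M, f, hM, hf⟩ := hℳ.contravariantlyFinite Y hY
  have key : ∀ (V : ModuleCat.{u} Λᵐᵒᵖ) (h : V ⟶ N), ℳ V →
      ((∃ v : V ⟶ M, v ≫ f ≫ g = h) ↔ ∀ t : X ⟶ V, t ≫ h ∈ H) := fun V h hV ↦ by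
    rw [← hg]
    constructor
    · rintro ⟨v, rfl⟩
      exact ⟨v ≫ f, Category.assoc _ _ _⟩
    · rintro ⟨v, rfl⟩
      obtain ⟨t, rfl⟩ := hf V v hV
      exact ⟨t, (Category.assoc _ _ _).symm⟩
  have himage : homImage X (f ≫ g) = H := by
    ext h
    rw [mem_homImage, key X h hX]
    -- `V = X` is allowed since `X` lies in `ℳ`; the identity tests membership in `H`.
    exact ⟨fun h' ↦ by simpa using h' (𝟙 X), fun hh t ↦ H.smul_mem (MulOpposite.op t) hh⟩
  refine ⟨M, f ≫ g, hM, fun V h hV hle ↦ (key V h hV).2 fun t ↦ ?_, himage⟩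
  rw [← himage]
  exact hle ((mem_homImage h _).2 ⟨t, rfl⟩)
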